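/- Let $\mathbf{B}$ be a pointed category (a category with chosen zero morphisms $0_{X,Y}:X\to Y$ satisfying $0f=0$ and $f0=0$; no zero object is assumed) with binary products, binary coproducts, kernels of split epimorphisms, and coequalizers of reflexive graphs (that is, of parallel pairs with a common section). **Notation.** $X\sqcup B$ is the coproduct with injections $\iota_1,\iota_2$, and $[f\ g]$ is the morphism out of it induced by $f,g$. Let $k=k_X:B\flat X\to X\sqcup B$ be the kernel of $[0\ 1]:X\sqcup B\to B$; let $b\flat x:B\flat X\to B'\flat X'$ be induced by $x\sqcup b$, let $\eta_X:X\to B\flat X$ be induced by $\iota_1$ and $\mu_X:B\flat(B\flat X)\to B\flat X$ by $[k\ \iota_2]$. $Act(\mathbf{B})$ has as objects the internal actions $(X,\xi,B)$, $\xi:B\flat X\to X$ with $\xi\eta_X=1$ and $\xi\mu_X=\xi(1\flat\xi)$, and as morphisms $(X,\xi,B)\to(X',\xi',B')$ the pairs $(x:X\to X',\,b:B\to B')$ with $\xi'(b\flat x)=x\xi$. $Pt(\mathbf{B})$ has as objects the split epimorphisms $(A,\alpha,\beta,B)$, $\alpha\beta=1_B$, and as morphisms the pairs commuting with the $\alpha$'s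 and the $\beta$'s. For an action $(X,\xi,B)$ let $\sigma:X\sqcup B\to F(X,B)$ be the coequalizer of $[k\ \iota_2]$ and $\xi\sqcup 1:(B\flat X)\sqcup B\to X\sqcup B$. If $[f\ g]k=f\xi$, let $\overline{[f\ g]}$ be the unique morphism with $\overline{[f\ g]}\sigma=[f\ g]$. A morphism $(x,b)$ of actions induces $F(x,b):F(X,B)\to F(X',B')$. The canonical functor $T:Act(\mathbf{B})\to Pt(\mathbf{B})$ sends $(X,\xi,B)$ to $(F(X,B),\overline{[0\ 1]},\sigma\iota_2,B)$ and $(x,b)$ to $(F(x,b),b)$. $RG(\mathbf{B})$ is the category of internal reflexive graphs $d,c:C_1\to C_0$, $e:C_0\to C_1$, $de=1=ce$. $PC(\mathbf{B})$ is the category of internal precategories: objects are systems $\pi_1,\pi_2,m:C_2\to C_1$, $e_1,e_2:C_1\to C_2$, $d,c:C_1\to C_0$, $e:C_0\to C_1$ such that $(\pi_1,c)$, with section $(e_1,e)$, is a split epimorphism from $(C_2,\pi_2,e_2,C_1)$ to $(C_1,d,e,C_0)$ in $Pt(\mathbf{B})$, and $dm=d\pi_2$, $cm=c\pi_1$, $me_1=1=me_2$.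 In both, morphisms are the families of morphisms commuting with all the structure morphisms. **Theorem.** If $T:Act(\mathbf{B})\to Pt(\mathbf{B})$ is an equivalence of categories, then there are equivalences of categories $$RG(\mathbf{B})\sim \text{Pre-X-Mod}(\mathbf{B}),\qquad PC(\mathbf{B})\sim \text{2-ChainComp}(\mathbf{B}),$$ where: * the objects of $\text{Pre-X-Mod}(\mathbf{B})$ are pairs $(h,\xi)$ with $h:X\to B$ a morphism of $\mathbf{B}$ and $(X,\xi,B)$ an internal action such that $[h\ 1]k=h\xi$; its morphisms are the morphisms $(x,b)$ of actions with $h'x=bh$; * the objects of $\text{2-ChainComp}(\mathbf{B})$ are sequences $Z\xrightarrow{t}X\xrightarrow{h}B$ with $ht=0$, together with internal actions $$\xi_X:B\flat X\to X,\quad \xi_Z:X\flat Z\to Z,\quad \xi_{F(Z,X)}:F(X,B)\flat F(Z,X)\to F(Z,X)$$ such that $$[h\ 1]k_X=h\xi_X,\qquad [t\ 1]k_Z=t\xi_Z,\qquad [\sigma\iota_1\overline{[t\ 1]}\ \ 1]\,k_{F(Z,X)}=\sigma\iota_1\overline{[t\ 1]}\,\xi_{F(Z,X)},$$ $$\overline{[0\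 1]}\,\xi_{F(Z,X)}=\xi_X\big(\overline{[h\ 1]}\flat\overline{[0\ 1]}\big),\qquad \sigma\iota_2\,\xi_X=\xi_{F(Z,X)}(\sigma\iota_2\flat\sigma\iota_2);$$ its morphisms are the triples $(z:Z\to Z',\,x:X\to X',\,b:B\to B')$ with $t'z=xt$ and $h'x=bh$ such that $(x,b)$, $(z,x)$ and $(F(z,x),F(x,b))$ are morphisms of actions for $\xi_X$, $\xi_Z$ and $\xi_{F(Z,X)}$ respectively. -/

import Mathlib

open CategoryTheory CategoryTheory.Limits

universe v u

noncomputable section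

namespace IntPrecat

/-! ### Split epimorphisms, reflexive graphs and precategories -/

section Plain

variable (C : Type u) [Category.{v} C]

/-- Objects of `Pt(C)`: split epimorphisms `α : A ⟶ B` with a specified section `β`. -/
structure Pt where
  A : C
  B : C
  α : A ⟶ B
  β : B ⟶ A
  split : β ≫ α = 𝟙 B

/-- Internal reflexive graphs in `C`. -/
structure RG where
  C₁ : C
  C₀ : C
  d : C₁ ⟶ C₀
  c : C₁ ⟶ C₀
  e : C₀ ⟶ C₁
  e_d : e ≫ d = 𝟙 C₀
  e_c : e ≫ c = 𝟙 C₀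

/-- Internal precategories in `C`. The fields from `e_d` to `e_e₁` say that `(π₁, c)`, with
section `(e₁, e)`, is a split epimorphism from `(C₂, π₂, e₂, C₁)` to `(C₁, d, e, C₀)` in the
category of split epimorphisms. -/
structure PC where
  C₂ : C
  C₁ : C
  C₀ : C
  π₁ : C₂ ⟶ C₁
  π₂ : C₂ ⟶ C₁
  m : C₂ ⟶ C₁
  e₁ : C₁ ⟶ C₂
  e₂ : C₁ ⟶ C₂
  d : C₁ ⟶ C₀
  c : C₁ ⟶ C₀
  e : C₀ ⟶ C₁
  e_d : e ≫ d = 𝟙 C₀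
  e_c : e ≫ c = 𝟙 C₀
  e₂_π₂ : e₂ ≫ π₂ = 𝟙 C₁
  e₁_π₁ : e₁ ≫ π₁ = 𝟙 C₁
  π₁_d : π₁ ≫ d = π₂ ≫ c
  e₂_π₁ : e₂ ≫ π₁ = c ≫ e
  e₁_π₂ : e₁ ≫ π₂ = d ≫ e
  e_e₁ : e ≫ e₁ = e ≫ e₂
  m_d : m ≫ d = π₂ ≫ d
  m_c : m ≫ c = π₁ ≫ c
  e₁_m : e₁ ≫ m = 𝟙 C₁
  e₂_m : e₂ ≫ m = 𝟙 C₁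

variable {C}

/-- Pasting of commutative squares, with the verticals composed. -/
theorem sq_paste {P P' P'' Q Q' Q'' : C} {f : P ⟶ P'} {f' : P' ⟶ P''} {g : Q ⟶ Q'}
    {g' : Q' ⟶ Q''} {p : P ⟶ Q} {p' : P' ⟶ Q'} {p'' : P'' ⟶ Q''}
    (w : f ≫ p' = p ≫ g) (w' : f' ≫ p'' = p' ≫ g') :
    (f ≫ f') ≫ p'' = p ≫ g ≫ g' := by
  rw [Category.assoc, w', ← Category.assoc, w, Category.assoc]

/-- Morphisms of split epimorphisms. -/
structure Pt.Hom (P Q : Pt C) where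
  f₁ : P.A ⟶ Q.A
  f₀ : P.B ⟶ Q.B
  comm_α : f₁ ≫ Q.α = P.α ≫ f₀
  comm_β : f₀ ≫ Q.β = P.β ≫ f₁

@[ext]
theorem Pt.Hom.ext' {P Q : Pt C} {f g : Pt.Hom P Q} (h₁ : f.f₁ = g.f₁) (h₀ : f.f₀ = g.f₀) :
    f = g := by
  cases f; cases g; cases h₁; cases h₀; rfl

instance : Category (Pt C) where
  Hom := Pt.Hom
  id P := ⟨𝟙 _, 𝟙 _, by simp, by simp⟩
  comp f g := ⟨f.f₁ ≫ g.f₁, f.f₀ ≫ g.f₀, sq_paste f.comm_α g.comm_α, sq_paste f.comm_β g.comm_β⟩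
  id_comp f := by apply Pt.Hom.ext' <;> simp
  comp_id f := by apply Pt.Hom.ext' <;> simp
  assoc f g h := by apply Pt.Hom.ext' <;> simp

/-- Morphisms of internal reflexive graphs. -/
structure RG.Hom (P Q : RG C) where
  f₁ : P.C₁ ⟶ Q.C₁
  f₀ : P.C₀ ⟶ Q.C₀
  comm_d : f₁ ≫ Q.d = P.d ≫ f₀
  comm_c : f₁ ≫ Q.c = P.c ≫ f₀
  comm_e : f₀ ≫ Q.e = P.e ≫ f₁

@[ext]
theorem RG.Hom.ext' {P Q : RG C} {f g : RG.Hom P Q} (h₁ : f.f₁ = g.f₁) (h₀ : f.f₀ = g.f₀) :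
    f = g := by
  cases f; cases g; cases h₁; cases h₀; rfl

instance : Category (RG C) where
  Hom := RG.Hom
  id P := ⟨𝟙 _, 𝟙 _, by simp, by simp, by simp⟩
  comp f g := ⟨f.f₁ ≫ g.f₁, f.f₀ ≫ g.f₀, sq_paste f.comm_d g.comm_d,
    sq_paste f.comm_c g.comm_c, sq_paste f.comm_e g.comm_e⟩
  id_comp f := by apply RG.Hom.ext' <;> simp
  comp_id f := by apply RG.Hom.ext' <;> simp
  assoc f g h := by apply RG.Hom.ext' <;> simp

/-- Morphisms of internal precategories. -/
structure PC.Hom (P Q : PC C) where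
  f₂ : P.C₂ ⟶ Q.C₂
  f₁ : P.C₁ ⟶ Q.C₁
  f₀ : P.C₀ ⟶ Q.C₀
  comm_π₁ : f₂ ≫ Q.π₁ = P.π₁ ≫ f₁
  comm_π₂ : f₂ ≫ Q.π₂ = P.π₂ ≫ f₁
  comm_m : f₂ ≫ Q.m = P.m ≫ f₁
  comm_e₁ : f₁ ≫ Q.e₁ = P.e₁ ≫ f₂
  comm_e₂ : f₁ ≫ Q.e₂ = P.e₂ ≫ f₂
  comm_d : f₁ ≫ Q.d = P.d ≫ f₀
  comm_c : f₁ ≫ Q.c = P.c ≫ f₀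
  comm_e : f₀ ≫ Q.e = P.e ≫ f₁

@[ext]
theorem PC.Hom.ext' {P Q : PC C} {f g : PC.Hom P Q} (h₂ : f.f₂ = g.f₂) (h₁ : f.f₁ = g.f₁)
    (h₀ : f.f₀ = g.f₀) : f = g := by
  cases f; cases g; cases h₂; cases h₁; cases h₀; rfl

instance : Category (PC C) where
  Hom := PC.Hom
  id P := ⟨𝟙 _, 𝟙 _, 𝟙 _, by simp, by simp, by simp, by simp, by simp, by simp, by simp, by simp⟩
  comp f g := ⟨f.f₂ ≫ g.f₂, f.f₁ ≫ g.f₁, f.f₀ ≫ g.f₀,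
    sq_paste f.comm_π₁ g.comm_π₁, sq_paste f.comm_π₂ g.comm_π₂, sq_paste f.comm_m g.comm_m,
    sq_paste f.comm_e₁ g.comm_e₁, sq_paste f.comm_e₂ g.comm_e₂, sq_paste f.comm_d g.comm_d,
    sq_paste f.comm_c g.comm_c, sq_paste f.comm_e g.comm_e⟩
  id_comp f := by apply PC.Hom.ext' <;> simp
  comp_id f := by apply PC.Hom.ext' <;> simp
  assoc f g h := by apply PC.Hom.ext' <;> simp

end Plain

/-! ### Internal actions -/

/-- Every split epimorphism has a kernel. -/
class HasKernelsOfSplitEpis (C : Type u) [Category.{v} C] [HasZeroMorphisms C] : Prop where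
  has_kernel : ∀ {A B : C} (f : A ⟶ B) [IsSplitEpi f], HasKernel f

section Actions

variable {C : Type u} [Category.{v} C] [HasZeroMorphisms C] [HasBinaryCoproducts C]
  [HasKernelsOfSplitEpis C]

/-- The split epimorphism `[0 1] : X ⊔ B ⟶ B`. -/
abbrev zeroOne (B X : C) : X ⨿ B ⟶ B := coprod.desc 0 (𝟙 B)

instance (B X : C) : IsSplitEpi (zeroOne B X) :=
  IsSplitEpi.mk' ⟨coprod.inr, coprod.inr_desc _ _⟩

instance (B X : C) : HasKernel (zeroOne B X) := HasKernelsOfSplitEpis.has_kernel _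

/-- The object `B ♭ X`, the kernel of `[0 1] : X ⊔ B ⟶ B`. -/
def flat (B X : C) : C := kernel (zeroOne B X)

/-- The kernel morphism `k : B ♭ X ⟶ X ⊔ B`. -/
def flatι (B X : C) : flat B X ⟶ X ⨿ B := kernel.ι (zeroOne B X)

instance (B X : C) : Mono (flatι B X) := inferInstanceAs (Mono (kernel.ι (zeroOne B X)))

theorem flatι_zeroOne (B X : C) : flatι B X ≫ zeroOne B X = 0 := kernel.condition _

/-- The factorization through `B ♭ X` of a morphism annihilated by `[0 1]`. -/
def flatLift {B X D : C} (f : D ⟶ X ⨿ B) (w : f ≫ zeroOne B X = 0) : D ⟶ flat B X :=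
  kernel.lift _ f w

theorem flatLift_ι {B X D : C} (f : D ⟶ X ⨿ B) (w : f ≫ zeroOne B X = 0) :
    flatLift f w ≫ flatι B X = f := kernel.lift_ι _ _ _

/-- The morphism `b ♭ x : B ♭ X ⟶ B' ♭ X'` induced by `x ⊔ b`. -/
def flatMap {B B' X X' : C} (b : B ⟶ B') (x : X ⟶ X') : flat B X ⟶ flat B' X' :=
  flatLift (flatι B X ≫ coprod.map x b) (by
    have h : coprod.map x b ≫ zeroOne B' X' = zeroOne B X ≫ b := by
      ext <;> simp
    rw [Category.assoc, h, ← Category.assoc, flatι_zeroOne, zero_comp])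

theorem flatMap_ι {B B' X X' : C} (b : B ⟶ B') (x : X ⟶ X') :
    flatMap b x ≫ flatι B' X' = flatι B X ≫ coprod.map x b := flatLift_ι _ _

theorem flatMap_id (B X : C) : flatMap (𝟙 B) (𝟙 X) = 𝟙 (flat B X) := by
  rw [← cancel_mono (flatι B X), flatMap_ι]
  simp

theorem flatMap_comp {B B' B'' X X' X'' : C} (b : B ⟶ B') (b' : B' ⟶ B'') (x : X ⟶ X')
    (x' : X' ⟶ X'') : flatMap (b ≫ b') (x ≫ x') = flatMap b x ≫ flatMap b' x' := by
  rw [← cancel_mono (flatι B'' X''), flatMap_ι, Category.assoc, flatMap_ι, ← Category.assoc,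
    flatMap_ι]
  simp

/-- `η : X ⟶ B ♭ X`, induced by `ι₁`. -/
def flatη (B X : C) : X ⟶ flat B X := flatLift coprod.inl (coprod.inl_desc _ _)

/-- `μ : B ♭ (B ♭ X) ⟶ B ♭ X`, induced by `[k ι₂]`. -/
def flatμ (B X : C) : flat B (flat B X) ⟶ flat B X :=
  flatLift (flatι B (flat B X) ≫ coprod.desc (flatι B X) coprod.inr) (by
    have h : coprod.desc (flatι B X) coprod.inr ≫ zeroOne B X = zeroOne B (flat B X) := by
      ext <;> simp [flatι_zeroOne, coprod.inl_desc, coprod.inr_desc]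
    rw [Category.assoc, h, flatι_zeroOne])

/-- Internal actions `ξ : B ♭ X ⟶ X` of `B` on `X`. -/
structure IntAction (B X : C) where
  ξ : flat B X ⟶ X
  unit : flatη B X ≫ ξ = 𝟙 X
  mul : flatμ B X ≫ ξ = flatMap (𝟙 B) ξ ≫ ξ

/-- `(b, x)` is a morphism from the action `s` to the action `s'`. -/
def IsEquivariant {B X B' X' : C} (s : IntAction B X) (s' : IntAction B' X') (b : B ⟶ B')
    (x : X ⟶ X') : Prop :=
  flatMap b x ≫ s'.ξ = s.ξ ≫ x

theorem IsEquivariant.id {B X : C} (s : IntAction B X) : IsEquivariant s s (𝟙 B) (𝟙 X) := by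
  simp [IsEquivariant, flatMap_id]

theorem IsEquivariant.comp {B X B' X' B'' X'' : C} {s : IntAction B X} {s' : IntAction B' X'}
    {s'' : IntAction B'' X''} {b : B ⟶ B'} {x : X ⟶ X'} {b' : B' ⟶ B''} {x' : X' ⟶ X''}
    (w : IsEquivariant s s' b x) (w' : IsEquivariant s' s'' b' x') :
    IsEquivariant s s'' (b ≫ b') (x ≫ x') := by
  unfold IsEquivariant at *
  rw [flatMap_comp, sq_paste w w']

variable (C) in
/-- Objects of `Act(C)`. -/
structure Act where
  X : C
  B : C
  action : IntAction B X

/-- Morphisms of `Act(C)`. -/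
structure Act.Hom (P Q : Act C) where
  x : P.X ⟶ Q.X
  b : P.B ⟶ Q.B
  equivariant : IsEquivariant P.action Q.action b x

@[ext]
theorem Act.Hom.ext' {P Q : Act C} {f g : Act.Hom P Q} (hx : f.x = g.x) (hb : f.b = g.b) :
    f = g := by
  cases f; cases g; cases hx; cases hb; rfl

instance : Category (Act C) where
  Hom := Act.Hom
  id P := ⟨𝟙 _, 𝟙 _, .id _⟩
  comp f g := ⟨f.x ≫ g.x, f.b ≫ g.b, f.equivariant.comp g.equivariant⟩
  id_comp f := by apply Act.Hom.ext' <;> simp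
  comp_id f := by apply Act.Hom.ext' <;> simp
  assoc f g h := by apply Act.Hom.ext' <;> simp

/-! ### Semidirect products and the canonical functor -/

variable [HasReflexiveCoequalizers C]

namespace IntAction

variable {B X : C} (s : IntAction B X)

instance : IsReflexivePair (coprod.desc (flatι B X) (coprod.inr : B ⟶ X ⨿ B))
    (coprod.map s.ξ (𝟙 B)) :=
  .mk' (coprod.map (flatη B X) (𝟙 B)) (by ext <;> simp [flatη, flatLift_ι])
    (by ext <;> simp [s.unit])

/-- The object `F(X, ξ, B)`, the coequalizer of `[k ι₂], ξ ⊔ 1 : (B ♭ X) ⊔ B ⟶ X ⊔ B`. -/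
def semi : C :=
  coequalizer (coprod.desc (flatι B X) (coprod.inr : B ⟶ X ⨿ B)) (coprod.map s.ξ (𝟙 B))

/-- The coequalizer morphism `σ : X ⊔ B ⟶ F(X, ξ, B)`. -/
def σ : X ⨿ B ⟶ s.semi := coequalizer.π _ _

/-- `σ ι₁ : X ⟶ F(X, ξ, B)`. -/
def inl : X ⟶ s.semi := coprod.inl ≫ s.σ

/-- `σ ι₂ : B ⟶ F(X, ξ, B)`. -/
def inr : B ⟶ s.semi := coprod.inr ≫ s.σ

theorem hom_ext {D : C} {p q : s.semi ⟶ D} (h₁ : s.inl ≫ p = s.inl ≫ q)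
    (h₂ : s.inr ≫ p = s.inr ≫ q) : p = q := by
  apply coequalizer.hom_ext
  change s.σ ≫ p = s.σ ≫ q
  ext
  · simpa [inl] using h₁
  · simpa [inr] using h₂

/-- The morphism out of `F(X, ξ, B)` induced by `[f g] : X ⊔ B ⟶ D` with `[f g] k = f ξ`. -/
def desc {D : C} (f : X ⟶ D) (g : B ⟶ D) (w : flatι B X ≫ coprod.desc f g = s.ξ ≫ f) :
    s.semi ⟶ D :=
  coequalizer.desc (coprod.desc f g) (by
    ext <;> simp [w, coprod.inl_desc, coprod.inr_desc])

theorem σ_desc {D : C} (f : X ⟶ D) (g : B ⟶ D)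
    (w : flatι B X ≫ coprod.desc f g = s.ξ ≫ f) : s.σ ≫ s.desc f g w = coprod.desc f g :=
  coequalizer.π_desc _ _

theorem inl_desc {D : C} (f : X ⟶ D) (g : B ⟶ D)
    (w : flatι B X ≫ coprod.desc f g = s.ξ ≫ f) : s.inl ≫ s.desc f g w = f := by
  simp [inl, σ_desc, coprod.inl_desc]

theorem inr_desc {D : C} (f : X ⟶ D) (g : B ⟶ D)
    (w : flatι B X ≫ coprod.desc f g = s.ξ ≫ f) : s.inr ≫ s.desc f g w = g := by
  simp [inr, σ_desc, coprod.inr_desc]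

/-- The morphism `F(X, ξ, B) ⟶ B` induced by `[0 1]`. -/
def proj : s.semi ⟶ B := s.desc 0 (𝟙 B) (by rw [comp_zero]; exact flatι_zeroOne B X)

theorem inl_proj : s.inl ≫ s.proj = 0 := s.inl_desc _ _ _

theorem inr_proj : s.inr ≫ s.proj = 𝟙 B := s.inr_desc _ _ _

theorem flatι_σ : flatι B X ≫ s.σ = s.ξ ≫ s.inl := by
  have h : coprod.desc (flatι B X) (coprod.inr : B ⟶ X ⨿ B) ≫ s.σ
      = coprod.map s.ξ (𝟙 B) ≫ s.σ := coequalizer.condition _ _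
  simpa [inl, coprod.inl_desc] using congrArg (fun p => coprod.inl ≫ p) h

variable {s}
variable {B' X' B'' X'' : C} {s' : IntAction B' X'} {s'' : IntAction B'' X''}

/-- The morphism `F(x, b) : F(X, ξ, B) ⟶ F(X', ξ', B')` induced by `x ⊔ b`. -/
def map {b : B ⟶ B'} {x : X ⟶ X'} (w : IsEquivariant s s' b x) : s.semi ⟶ s'.semi :=
  s.desc (x ≫ s'.inl) (b ≫ s'.inr) (by
    have h : coprod.desc (x ≫ s'.inl) (b ≫ s'.inr) = coprod.map x b ≫ s'.σ := by
      ext <;> simp [inl, inr, coprod.inl_desc, coprod.inr_desc]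
    unfold IsEquivariant at w
    rw [h, ← Category.assoc, ← flatMap_ι, Category.assoc, flatι_σ, ← Category.assoc, w,
      Category.assoc])

theorem inl_map {b : B ⟶ B'} {x : X ⟶ X'} (w : IsEquivariant s s' b x) :
    s.inl ≫ map w = x ≫ s'.inl := s.inl_desc _ _ _

theorem inr_map {b : B ⟶ B'} {x : X ⟶ X'} (w : IsEquivariant s s' b x) :
    s.inr ≫ map w = b ≫ s'.inr := s.inr_desc _ _ _

theorem map_proj {b : B ⟶ B'} {x : X ⟶ X'} (w : IsEquivariant s s' b x) :
    map w ≫ s'.proj = s.proj ≫ b := by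
  apply hom_ext
  · rw [← Category.assoc, inl_map, Category.assoc, inl_proj, ← Category.assoc, inl_proj]
    simp
  · rw [← Category.assoc, inr_map, Category.assoc, inr_proj, ← Category.assoc, inr_proj]
    simp

theorem map_id : map (IsEquivariant.id s) = 𝟙 s.semi := by
  apply hom_ext
  · rw [inl_map]; simp
  · rw [inr_map]; simp

theorem map_comp {b : B ⟶ B'} {x : X ⟶ X'} {b' : B' ⟶ B''} {x' : X' ⟶ X''}
    (w : IsEquivariant s s' b x) (w' : IsEquivariant s' s'' b' x') :
    map (w.comp w') = map w ≫ map w' := by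
  apply hom_ext
  · rw [inl_map, ← Category.assoc, inl_map, Category.assoc, Category.assoc, inl_map]
  · rw [inr_map, ← Category.assoc, inr_map, Category.assoc, Category.assoc, inr_map]

end IntAction

variable (C) in
/-- The canonical functor `T : Act(C) ⥤ Pt(C)`. -/
def canonicalFunctor : Act C ⥤ Pt C where
  obj P := ⟨P.action.semi, P.B, P.action.proj, P.action.inr, P.action.inr_proj⟩
  map f := ⟨IntAction.map f.equivariant, f.b, IntAction.map_proj _, (IntAction.inr_map _).symm⟩
  map_id _ := Pt.Hom.ext' IntAction.map_id rfl
  map_comp f g := Pt.Hom.ext' (IntAction.map_comp f.equivariant g.equivariant) rfl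

end Actions

/-! ### Precrossed modules -/

section PreXMod

variable (C : Type u) [Category.{v} C] [HasZeroMorphisms C] [HasBinaryCoproducts C]
  [HasKernelsOfSplitEpis C]

/-- Objects of `Pre-X-Mod(C)`. -/
structure PreXMod where
  X : C
  B : C
  h : X ⟶ B
  action : IntAction B X
  precrossed : flatι B X ≫ coprod.desc h (𝟙 B) = action.ξ ≫ h

variable {C}

/-- Morphisms of `Pre-X-Mod(C)`: morphisms of actions that commute with `h`. -/
structure PreXMod.Hom (P Q : PreXMod C) where
  x : P.X ⟶ Q.X
  b : P.B ⟶ Q.B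
  comm_h : x ≫ Q.h = P.h ≫ b
  equivariant : IsEquivariant P.action Q.action b x

@[ext]
theorem PreXMod.Hom.ext' {P Q : PreXMod C} {f g : PreXMod.Hom P Q} (hx : f.x = g.x)
    (hb : f.b = g.b) : f = g := by
  cases f; cases g; cases hx; cases hb; rfl

instance : Category (PreXMod C) where
  Hom := PreXMod.Hom
  id P := ⟨𝟙 _, 𝟙 _, by simp, .id _⟩
  comp f g := ⟨f.x ≫ g.x, f.b ≫ g.b, sq_paste f.comm_h g.comm_h,
    f.equivariant.comp g.equivariant⟩
  id_comp f := by apply PreXMod.Hom.ext' <;> simp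
  comp_id f := by apply PreXMod.Hom.ext' <;> simp
  assoc f g h := by apply PreXMod.Hom.ext' <;> simp

end PreXMod

/-! ### 2-chain complexes with actions -/

section TwoChainComp

variable (C : Type u) [Category.{v} C] [HasZeroMorphisms C] [HasBinaryCoproducts C]
  [HasKernelsOfSplitEpis C] [HasReflexiveCoequalizers C]

/-- Objects of `2-ChainComp(C)`. -/
structure TwoChainComp where
  Z : C
  X : C
  B : C
  t : Z ⟶ X
  h : X ⟶ B
  zero : t ≫ h = 0
  /-- `ξ_X : B ♭ X ⟶ X` -/
  actX : IntAction B X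
  /-- `ξ_Z : X ♭ Z ⟶ Z` -/
  actZ : IntAction X Z
  /-- `ξ_{F(Z,X)} : F(X,B) ♭ F(Z,X) ⟶ F(Z,X)` -/
  actF : IntAction actX.semi actZ.semi
  condX : flatι B X ≫ coprod.desc h (𝟙 B) = actX.ξ ≫ h
  condZ : flatι X Z ≫ coprod.desc t (𝟙 X) = actZ.ξ ≫ t
  condF : flatι actX.semi actZ.semi ≫
      coprod.desc (actZ.desc t (𝟙 X) condZ ≫ actX.inl) (𝟙 actX.semi) =
    actF.ξ ≫ actZ.desc t (𝟙 X) condZ ≫ actX.inl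
  proj_comm : actF.ξ ≫ actZ.proj = flatMap (actX.desc h (𝟙 B) condX) actZ.proj ≫ actX.ξ
  inr_comm : actX.ξ ≫ actZ.inr = flatMap actX.inr actZ.inr ≫ actF.ξ

variable {C}

/-- Morphisms of `2-ChainComp(C)`: morphisms of chain complexes compatible with the actions. -/
structure TwoChainComp.Hom (P Q : TwoChainComp C) where
  z : P.Z ⟶ Q.Z
  x : P.X ⟶ Q.X
  b : P.B ⟶ Q.B
  comm_t : z ≫ Q.t = P.t ≫ x
  comm_h : x ≫ Q.h = P.h ≫ b
  equivX : IsEquivariant P.actX Q.actX b x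
  equivZ : IsEquivariant P.actZ Q.actZ x z
  equivF : IsEquivariant P.actF Q.actF (IntAction.map equivX) (IntAction.map equivZ)

@[ext]
theorem TwoChainComp.Hom.ext' {P Q : TwoChainComp C} {f g : TwoChainComp.Hom P Q}
    (hz : f.z = g.z) (hx : f.x = g.x) (hb : f.b = g.b) : f = g := by
  cases f; cases g; cases hz; cases hx; cases hb; rfl

instance : Category (TwoChainComp C) where
  Hom := TwoChainComp.Hom
  id P := ⟨𝟙 _, 𝟙 _, 𝟙 _, by simp, by simp, .id _, .id _, by
    rw [IntAction.map_id, IntAction.map_id]; exact .id _⟩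
  comp f g := ⟨f.z ≫ g.z, f.x ≫ g.x, f.b ≫ g.b, sq_paste f.comm_t g.comm_t,
    sq_paste f.comm_h g.comm_h, f.equivX.comp g.equivX, f.equivZ.comp g.equivZ, by
    rw [IntAction.map_comp f.equivX g.equivX, IntAction.map_comp f.equivZ g.equivZ]
    exact f.equivF.comp g.equivF⟩
  id_comp f := by apply TwoChainComp.Hom.ext' <;> simp
  comp_id f := by apply TwoChainComp.Hom.ext' <;> simp
  assoc f g h := by apply TwoChainComp.Hom.ext' <;> simp

end TwoChainComp

end IntPrecat

end

/-! The hypothesis on `T` lets every split epimorphism be replaced by a projection F(X,B) → B, and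
every morphism of split epimorphisms by a morphism of actions. A morphism out of F(X,B) that
restricts to the identity on B is the same as some h on X with [h 1]k = hξ. A reflexive graph is a
split epimorphism (d, e) with such a morphism c, hence a precrossed module.

For a precategory, (d, e) gives an action of C₀ on some X, and (π₂, e₂) an action of C₁ on some Y.
The pairs (π₁, c) and (e₁, e) become morphisms of actions p : Y → X and q : X → Y with pq = 1, so Y
is itself some F(Z,X). Since dm = dπ₂, the restriction of m to Y lands in the kernel X of d, and me₁
= 1 makes it the identity on X. It is therefore of the form [t 1], and cm = cπ₁ becomes ht = 0.

The argument needs σι₁ : X → F(X,B) to be a kernel of the projection. Without a zero object this is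
obtained by testing against free actions on B ♭ D: faithfulness of `T` gives `inl_mono`, fullness
gives `exists_lift_inl`. Essential surjectivity enters through `exists_semi_iso`. -/

noncomputable section

namespace IntPrecat

/-! ### Free actions and transport of actions -/

section

variable {C : Type u} [Category.{v} C] [HasZeroMorphisms C] [HasBinaryCoproducts C]
  [HasKernelsOfSplitEpis C]

theorem flatη_ι (B X : C) : flatη B X ≫ flatι B X = coprod.inl := flatLift_ι _ _

theorem flatμ_ι (B X : C) :
    flatμ B X ≫ flatι B X = flatι B (flat B X) ≫ coprod.desc (flatι B X) coprod.inr :=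
  flatLift_ι _ _

theorem flatη_naturality {B B' X X' : C} (b : B ⟶ B') (x : X ⟶ X') :
    flatη B X ≫ flatMap b x = x ≫ flatη B' X' := by
  rw [← cancel_mono (flatι B' X'), Category.assoc, flatMap_ι, ← Category.assoc, flatη_ι,
    Category.assoc, flatη_ι, coprod.inl_map]

theorem flatμ_naturality {B B' X X' : C} (b : B ⟶ B') (x : X ⟶ X') :
    flatμ B X ≫ flatMap b x = flatMap b (flatMap b x) ≫ flatμ B' X' := by
  rw [← cancel_mono (flatι B' X'), Category.assoc, Category.assoc, flatMap_ι, flatμ_ι,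
    reassoc_of% flatμ_ι, reassoc_of% flatMap_ι]
  congr 1
  ext <;> simp [flatMap_ι]

/-- The free action of `B` on `B ♭ D`. -/
def IntAction.free (B D : C) : IntAction B (flat B D) where
  ξ := flatμ B D
  unit := by
    rw [← cancel_mono (flatι B D), Category.assoc, flatμ_ι, reassoc_of% flatη_ι, coprod.inl_desc,
      Category.id_comp]
  mul := by
    rw [← cancel_mono (flatι B D), Category.assoc, Category.assoc, flatμ_ι, reassoc_of% flatμ_ι,
      reassoc_of% flatMap_ι]
    congr 1
    ext <;> simp [flatμ_ι, coprod.inl_desc, coprod.inr_desc]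

/-- The equivariant morphism out of a free action induced by a morphism of its generators. -/
theorem IntAction.free_isEquivariant {B X D : C} (s : IntAction B X) (p : D ⟶ X) :
    IsEquivariant (free B D) s (𝟙 B) (flatMap (𝟙 B) p ≫ s.ξ) := by
  have h := flatMap_comp (𝟙 B) (𝟙 B) (flatMap (𝟙 B) p) s.ξ
  rw [Category.comp_id] at h
  change _ = flatμ B D ≫ _
  rw [h, Category.assoc, ← s.mul, reassoc_of% flatμ_naturality]

/-- A morphism of generators is recovered from its equivariant extension, so equality of extensions
can be tested instead. -/
theorem IntAction.flatη_map_ξ {B X D : C} (s : IntAction B X) (p : D ⟶ X) :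
    flatη B D ≫ flatMap (𝟙 B) p ≫ s.ξ = p := by
  rw [reassoc_of% flatη_naturality, s.unit, Category.comp_id]

/-- Transport of an action along isomorphisms. -/
def IntAction.transport {B X B' X' : C} (s : IntAction B X) (b : B ≅ B') (x : X ≅ X') :
    IntAction B' X' where
  ξ := flatMap b.inv x.inv ≫ s.ξ ≫ x.hom
  unit := by
    rw [reassoc_of% flatη_naturality, reassoc_of% s.unit, x.inv_hom_id]
  mul := by
    rw [reassoc_of% flatμ_naturality, reassoc_of% s.mul, ← reassoc_of% flatMap_comp,
      ← reassoc_of% flatMap_comp]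
    simp

theorem IntAction.transport_isEquivariant {B X B' X' : C} (s : IntAction B X) (b : B ≅ B')
    (x : X ≅ X') : IsEquivariant s (s.transport b x) b.hom x.hom := by
  change _ ≫ flatMap _ _ ≫ _ ≫ _ = _
  rw [← reassoc_of% flatMap_comp, b.hom_inv_id, x.hom_inv_id, flatMap_id, Category.id_comp]

theorem IsEquivariant.inv {B X B' X' : C} {s : IntAction B X} {s' : IntAction B' X'}
    {b : B ≅ B'} {x : X ≅ X'} (w : IsEquivariant s s' b.hom x.hom) :
    IsEquivariant s' s b.inv x.inv := by
  unfold IsEquivariant at *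
  rw [← cancel_mono x.hom, Category.assoc, Category.assoc, ← w, ← reassoc_of% flatMap_comp]
  simp [flatMap_id]

end

/-! ### Semidirect products when the canonical functor is faithful, full or essentially surjective
-/

section

variable {C : Type u} [Category.{v} C] [HasZeroMorphisms C] [HasBinaryCoproducts C]
  [HasKernelsOfSplitEpis C] [HasReflexiveCoequalizers C]

namespace IntAction

theorem desc_comp_σ {B X D : C} (s : IntAction B X) (f : s.semi ⟶ D) :
    coprod.desc (s.inl ≫ f) (s.inr ≫ f) = s.σ ≫ f := by
  ext <;> simp [inl, inr, coprod.inl_desc, coprod.inr_desc]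

/-- The compatibility of the two restrictions of a morphism out of a semidirect product. -/
theorem flatι_desc {B X D : C} (s : IntAction B X) (f : s.semi ⟶ D) :
    flatι B X ≫ coprod.desc (s.inl ≫ f) (s.inr ≫ f) = s.ξ ≫ s.inl ≫ f := by
  rw [desc_comp_σ, reassoc_of% flatι_σ]

/-- Source of all conditions of the form [h 1]k = hξ when an action is extracted from a graph or
precategory. -/
theorem flatι_desc_of_eq {B X D : C} (s : IntAction B X) (f : s.semi ⟶ D) {p : X ⟶ D}
    {q : B ⟶ D} (hp : s.inl ≫ f = p) (hq : s.inr ≫ f = q) :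
    flatι B X ≫ coprod.desc p q = s.ξ ≫ p := by
  subst hp hq
  exact s.flatι_desc f

theorem eq_desc {B X D : C} (s : IntAction B X) (f : s.semi ⟶ D) {p : X ⟶ D}
    {q : B ⟶ D} (hp : s.inl ≫ f = p) (hq : s.inr ≫ f = q)
    (w : flatι B X ≫ coprod.desc p q = s.ξ ≫ p) : s.desc p q w = f :=
  s.hom_ext (by rw [inl_desc, hp]) (by rw [inr_desc, hq])

/-- The isomorphism of semidirect products induced by an isomorphism of actions. -/
def mapIso {B X B' X' : C} {s : IntAction B X} {s' : IntAction B' X'}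
    {b : B ≅ B'} {x : X ≅ X'} (w : IsEquivariant s s' b.hom x.hom) : s.semi ≅ s'.semi where
  hom := map w
  inv := map w.inv
  hom_inv_id := by
    apply hom_ext
    · rw [reassoc_of% inl_map, inl_map]; simp
    · rw [reassoc_of% inr_map, inr_map]; simp
  inv_hom_id := by
    apply hom_ext
    · rw [reassoc_of% inl_map, inl_map]; simp
    · rw [reassoc_of% inr_map, inr_map]; simp

section Faithful

variable [(canonicalFunctor C).Faithful] {B X B' X' : C} {s : IntAction B X}
  {s' : IntAction B' X'}

theorem map_injective {b : B ⟶ B'} {x x' : X ⟶ X'} (w : IsEquivariant s s' b x)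
    (w' : IsEquivariant s s' b x') (h : s.inl ≫ map w = s.inl ≫ map w') : x = x' := by
  let f : Act.mk X B s ⟶ Act.mk X' B' s' := Act.Hom.mk x b w
  let f' : Act.mk X B s ⟶ Act.mk X' B' s' := Act.Hom.mk x' b w'
  have hw : map w = map w' := s.hom_ext h (by rw [inr_map, inr_map])
  have e : f = f' := (canonicalFunctor C).map_injective (Pt.Hom.ext' hw rfl)
  exact congrArg Act.Hom.x e

/-- Extend p and q to equivariant morphisms from the free action of B on B ♭ D. As σι₁ξ = σk, these
induce the same morphism of semidirect products, so faithfulness identifies them. -/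
instance inl_mono : Mono s.inl where
  right_cancellation {D} p q h := by
    have e : flatMap (𝟙 B) p ≫ s.ξ = flatMap (𝟙 B) q ≫ s.ξ := by
      apply map_injective (s.free_isEquivariant p) (s.free_isEquivariant q)
      have h' : coprod.map p (𝟙 B) ≫ s.σ = coprod.map q (𝟙 B) ≫ s.σ := by
        ext <;> simp
        exact h
      rw [inl_map, inl_map, Category.assoc, Category.assoc, ← flatι_σ, reassoc_of% flatMap_ι,
        reassoc_of% flatMap_ι, h']
    rw [← s.flatη_map_ξ p, e, s.flatη_map_ξ]

end Faithful

section Full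

variable [(canonicalFunctor C).Full] {B X B' X' : C} {s : IntAction B X} {s' : IntAction B' X'}

theorem exists_map_eq (f : s.semi ⟶ s'.semi) (b : B ⟶ B') (hα : f ≫ s'.proj = s.proj ≫ b)
    (hβ : b ≫ s'.inr = s.inr ≫ f) : ∃ (x : X ⟶ X') (w : IsEquivariant s s' b x), map w = f := by
  let g : (canonicalFunctor C).obj (Act.mk X B s) ⟶ (canonicalFunctor C).obj (Act.mk X' B' s') :=
    Pt.Hom.mk f b hα hβ
  obtain ⟨⟨x, b', w⟩, h⟩ := (canonicalFunctor C).map_surjective g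
  have hb : b' = b := congrArg Pt.Hom.f₀ h
  subst hb
  exact ⟨x, w, congrArg Pt.Hom.f₁ h⟩

/-- Together with `inl_mono`, this makes `s.inl` a kernel of `s.proj`. Fullness is applied to a
morphism from the semidirect product of the free action on B ♭ D, and the result is restricted along
η. -/
theorem exists_lift_inl {D : C} (g : D ⟶ s.semi) (hg : g ≫ s.proj = 0) :
    ∃ y : D ⟶ X, y ≫ s.inl = g := by
  -- This is [g σι₂] : D ⊔ B → F(X,B), precomposed with the morphism F(B ♭ D, B) → D ⊔ B induced by
  -- [k ι₂].
  let f : (free B D).semi ⟶ s.semi := (free B D).desc (flatι B D ≫ coprod.desc g s.inr) s.inr (by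
    change _ = flatμ B D ≫ _
    rw [reassoc_of% flatμ_ι]
    congr 1
    ext <;> simp [coprod.inl_desc, coprod.inr_desc])
  have h : coprod.desc g s.inr ≫ s.proj = zeroOne B D := by
    ext <;> simp [hg, inr_proj]
  obtain ⟨y, w, e⟩ := exists_map_eq f (𝟙 B)
    ((free B D).hom_ext
      (by rw [reassoc_of% inl_desc, Category.assoc, h, flatι_zeroOne, reassoc_of% inl_proj, zero_comp])
      (by rw [reassoc_of% inr_desc, inr_proj, reassoc_of% inr_proj]))
    (by rw [inr_desc, Category.id_comp])
  refine ⟨flatη B D ≫ y, ?_⟩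
  rw [Category.assoc, ← inl_map w, e, inl_desc, reassoc_of% flatη_ι, coprod.inl_desc]

end Full

/-- Essential surjectivity only gives the base up to isomorphism; transporting the action along that
isomorphism makes the base equal to B, so that actions can be stacked. -/
theorem exists_semi_iso [(canonicalFunctor C).EssSurj] {A B : C} (α : A ⟶ B) (β : B ⟶ A)
    (h : β ≫ α = 𝟙 B) : ∃ (X : C) (s : IntAction B X) (φ : s.semi ≅ A),
      φ.hom ≫ α = s.proj ∧ s.inr ≫ φ.hom = β := by
  let P : Pt C := ⟨A, B, α, β, h⟩
  let R := (canonicalFunctor C).objPreimage P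
  let e : (canonicalFunctor C).obj R ≅ P := (canonicalFunctor C).objObjPreimageIso P
  let e₁ : R.action.semi ≅ A := ⟨e.hom.f₁, e.inv.f₁, congrArg Pt.Hom.f₁ e.hom_inv_id,
    congrArg Pt.Hom.f₁ e.inv_hom_id⟩
  let e₀ : R.B ≅ B := ⟨e.hom.f₀, e.inv.f₀, congrArg Pt.Hom.f₀ e.hom_inv_id,
    congrArg Pt.Hom.f₀ e.inv_hom_id⟩
  have hα : e₁.hom ≫ α = R.action.proj ≫ e₀.hom := e.hom.comm_α
  have hβ : e₀.hom ≫ β = R.action.inr ≫ e₁.hom := e.hom.comm_β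
  have w := R.action.transport_isEquivariant e₀ (Iso.refl R.X)
  refine ⟨R.X, R.action.transport e₀ (Iso.refl _),
    (mapIso w).symm ≪≫ e₁, ?_, ?_⟩
  · change (map w.inv ≫ _) ≫ _ = _
    rw [Category.assoc, hα, reassoc_of% map_proj, e₀.inv_hom_id, Category.comp_id]
  · change _ ≫ map w.inv ≫ _ = _
    rw [reassoc_of% inr_map, ← hβ, e₀.inv_hom_id_assoc]

end IntAction

end

/-! ### Isomorphisms of reflexive graphs and of precategories -/

section

variable {C : Type u} [Category.{v} C]

/-- An isomorphism of reflexive graphs from isomorphisms of components. -/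
def RG.isoMk {P Q : RG C} (f : RG.Hom P Q) (e₁ : P.C₁ ≅ Q.C₁) (e₀ : P.C₀ ≅ Q.C₀)
    (h₁ : f.f₁ = e₁.hom) (h₀ : f.f₀ = e₀.hom) : P ≅ Q where
  hom := f
  inv :=
    { f₁ := e₁.inv
      f₀ := e₀.inv
      comm_d := by rw [Iso.inv_comp_eq, ← Category.assoc, Iso.eq_comp_inv, ← h₁, ← h₀, f.comm_d]
      comm_c := by rw [Iso.inv_comp_eq, ← Category.assoc, Iso.eq_comp_inv, ← h₁, ← h₀, f.comm_c]
      comm_e := by rw [Iso.inv_comp_eq, ← Category.assoc, Iso.eq_comp_inv, ← h₁, ← h₀, f.comm_e] }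
  hom_inv_id := RG.Hom.ext' (by change f.f₁ ≫ e₁.inv = 𝟙 _; rw [h₁, e₁.hom_inv_id])
    (by change f.f₀ ≫ e₀.inv = 𝟙 _; rw [h₀, e₀.hom_inv_id])
  inv_hom_id := RG.Hom.ext' (by change e₁.inv ≫ f.f₁ = 𝟙 _; rw [h₁, e₁.inv_hom_id])
    (by change e₀.inv ≫ f.f₀ = 𝟙 _; rw [h₀, e₀.inv_hom_id])

/-- An isomorphism of precategories from isomorphisms of components. -/
def PC.isoMk {P Q : PC C} (f : PC.Hom P Q) (e₂ : P.C₂ ≅ Q.C₂) (e₁ : P.C₁ ≅ Q.C₁)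
    (e₀ : P.C₀ ≅ Q.C₀) (h₂ : f.f₂ = e₂.hom) (h₁ : f.f₁ = e₁.hom) (h₀ : f.f₀ = e₀.hom) :
    P ≅ Q where
  hom := f
  inv :=
    { f₂ := e₂.inv
      f₁ := e₁.inv
      f₀ := e₀.inv
      comm_π₁ := by rw [Iso.inv_comp_eq, ← Category.assoc, Iso.eq_comp_inv, ← h₂, ← h₁, f.comm_π₁]
      comm_π₂ := by rw [Iso.inv_comp_eq, ← Category.assoc, Iso.eq_comp_inv, ← h₂, ← h₁, f.comm_π₂]
      comm_m := by rw [Iso.inv_comp_eq, ← Category.assoc, Iso.eq_comp_inv, ← h₂, ← h₁, f.comm_m]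
      comm_e₁ := by rw [Iso.inv_comp_eq, ← Category.assoc, Iso.eq_comp_inv, ← h₂, ← h₁, f.comm_e₁]
      comm_e₂ := by rw [Iso.inv_comp_eq, ← Category.assoc, Iso.eq_comp_inv, ← h₂, ← h₁, f.comm_e₂]
      comm_d := by rw [Iso.inv_comp_eq, ← Category.assoc, Iso.eq_comp_inv, ← h₁, ← h₀, f.comm_d]
      comm_c := by rw [Iso.inv_comp_eq, ← Category.assoc, Iso.eq_comp_inv, ← h₁, ← h₀, f.comm_c]
      comm_e := by rw [Iso.inv_comp_eq, ← Category.assoc, Iso.eq_comp_inv, ← h₁, ← h₀, f.comm_e] }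
  hom_inv_id := PC.Hom.ext' (by change f.f₂ ≫ e₂.inv = 𝟙 _; rw [h₂, e₂.hom_inv_id])
    (by change f.f₁ ≫ e₁.inv = 𝟙 _; rw [h₁, e₁.hom_inv_id])
    (by change f.f₀ ≫ e₀.inv = 𝟙 _; rw [h₀, e₀.hom_inv_id])
  inv_hom_id := PC.Hom.ext' (by change e₂.inv ≫ f.f₂ = 𝟙 _; rw [h₂, e₂.inv_hom_id])
    (by change e₁.inv ≫ f.f₁ = 𝟙 _; rw [h₁, e₁.inv_hom_id])
    (by change e₀.inv ≫ f.f₀ = 𝟙 _; rw [h₀, e₀.inv_hom_id])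

end

/-! ### Precrossed modules and reflexive graphs -/

section

open IntAction

variable {C : Type u} [Category.{v} C] [HasZeroMorphisms C] [HasBinaryCoproducts C]
  [HasKernelsOfSplitEpis C] [HasReflexiveCoequalizers C]

theorem map_desc_comm {B X B' X' : C} {s : IntAction B X} {s' : IntAction B' X'} {h : X ⟶ B}
    {h' : X' ⟶ B'} (c : flatι B X ≫ coprod.desc h (𝟙 B) = s.ξ ≫ h)
    (c' : flatι B' X' ≫ coprod.desc h' (𝟙 B') = s'.ξ ≫ h') {b : B ⟶ B'} {x : X ⟶ X'}
    (w : IsEquivariant s s' b x) (hx : x ≫ h' = h ≫ b) :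
    IntAction.map w ≫ s'.desc h' (𝟙 B') c' = s.desc h (𝟙 B) c ≫ b := by
  apply s.hom_ext
  · rw [reassoc_of% inl_map, reassoc_of% s.inl_desc, s'.inl_desc, hx]
  · rw [reassoc_of% inr_map, reassoc_of% s.inr_desc, s'.inr_desc, Category.comp_id,
      Category.id_comp]

theorem comm_of_map_desc_comm {B X B' X' : C} {s : IntAction B X} {s' : IntAction B' X'}
    {h : X ⟶ B} {h' : X' ⟶ B'} (c : flatι B X ≫ coprod.desc h (𝟙 B) = s.ξ ≫ h)
    (c' : flatι B' X' ≫ coprod.desc h' (𝟙 B') = s'.ξ ≫ h') {b : B ⟶ B'} {x : X ⟶ X'}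
    (w : IsEquivariant s s' b x)
    (e : IntAction.map w ≫ s'.desc h' (𝟙 B') c' = s.desc h (𝟙 B) c ≫ b) : x ≫ h' = h ≫ b := by
  rw [← s'.inl_desc h' (𝟙 B') c', ← reassoc_of% inl_map w, e, reassoc_of% s.inl_desc]

/-- Here and in `map_eq_comp` the components are equal only propositionally, as happens when they
are themselves of the form `map`. -/
theorem map_eq_id {B X : C} {s : IntAction B X} {b : B ⟶ B} {x : X ⟶ X}
    (w : IsEquivariant s s b x) (hb : b = 𝟙 B) (hx : x = 𝟙 X) : IntAction.map w = 𝟙 s.semi := by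
  subst hb hx
  exact map_id

theorem map_eq_comp {B X B' X' B'' X'' : C} {s : IntAction B X} {s' : IntAction B' X'}
    {s'' : IntAction B'' X''} {b : B ⟶ B'} {x : X ⟶ X'} {b' : B' ⟶ B''} {x' : X' ⟶ X''}
    {b'' : B ⟶ B''} {x'' : X ⟶ X''} (w : IsEquivariant s s' b x)
    (w' : IsEquivariant s' s'' b' x') (w'' : IsEquivariant s s'' b'' x'') (hb : b'' = b ≫ b')
    (hx : x'' = x ≫ x') : IntAction.map w'' = IntAction.map w ≫ IntAction.map w' := by
  subst hb hx
  exact map_comp w w'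

variable (C) in
/-- The reflexive graph of a precrossed module. -/
def PreXMod.toRG : PreXMod C ⥤ RG C where
  obj P :=
    { C₁ := P.action.semi
      C₀ := P.B
      d := P.action.proj
      c := P.action.desc P.h (𝟙 _) P.precrossed
      e := P.action.inr
      e_d := P.action.inr_proj
      e_c := P.action.inr_desc _ _ _ }
  map {P Q} f :=
    { f₁ := IntAction.map f.equivariant
      f₀ := f.b
      comm_d := map_proj _
      comm_c := map_desc_comm P.precrossed Q.precrossed f.equivariant f.comm_h
      comm_e := (inr_map _).symm }
  map_id _ := RG.Hom.ext' map_id rfl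
  map_comp f g := RG.Hom.ext' (map_comp f.equivariant g.equivariant) rfl

instance [(canonicalFunctor C).Faithful] : (PreXMod.toRG C).Faithful where
  map_injective {P Q f g} h := by
    have hb : f.b = g.b := congrArg RG.Hom.f₀ h
    have h₁ : IntAction.map f.equivariant = IntAction.map g.equivariant := congrArg RG.Hom.f₁ h
    refine PreXMod.Hom.ext' ?_ hb
    rw [← cancel_mono Q.action.inl, ← inl_map f.equivariant, h₁, inl_map]

instance [(canonicalFunctor C).Full] : (PreXMod.toRG C).Full where
  map_surjective {P Q} f := by
    obtain ⟨x, w, h⟩ := exists_map_eq (s := P.action) (s' := Q.action) f.f₁ f.f₀ f.comm_d f.comm_e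
    exact ⟨PreXMod.Hom.mk x f.f₀ (comm_of_map_desc_comm P.precrossed Q.precrossed w
      ((congrArg (· ≫ _) h).trans f.comm_c)) w, RG.Hom.ext' h rfl⟩

instance [(canonicalFunctor C).EssSurj] : (PreXMod.toRG C).EssSurj where
  mem_essImage R := by
    obtain ⟨X, s, φ, hα, hβ⟩ := exists_semi_iso R.d R.e R.e_d
    have hr : s.inr ≫ φ.hom ≫ R.c = 𝟙 _ := by rw [reassoc_of% hβ, R.e_c]
    let P : PreXMod C := ⟨X, R.C₀, s.inl ≫ φ.hom ≫ R.c, s, s.flatι_desc_of_eq _ rfl hr⟩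
    let f : RG.Hom ((PreXMod.toRG C).obj P) R :=
      { f₁ := φ.hom
        f₀ := 𝟙 R.C₀
        comm_d := hα.trans (Category.comp_id _).symm
        comm_c := (s.eq_desc _ rfl hr P.precrossed).symm.trans (Category.comp_id _).symm
        comm_e := (Category.id_comp _).trans hβ.symm }
    exact ⟨P, ⟨RG.isoMk f φ (Iso.refl _) rfl rfl⟩⟩

/-! ### The precategory of a 2-chain complex -/

/-- The last two axioms of a 2-chain complex say that two pairs are morphisms of actions; applying F
to them yields π₁ and e₁. -/
theorem TwoChainComp.proj_isEquivariant (P : TwoChainComp C) :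
    IsEquivariant P.actF P.actX (P.actX.desc P.h (𝟙 _) P.condX) P.actZ.proj :=
  P.proj_comm.symm

theorem TwoChainComp.inr_isEquivariant (P : TwoChainComp C) :
    IsEquivariant P.actX P.actF P.actX.inr P.actZ.inr :=
  P.inr_comm.symm

/-- The precategory of a 2-chain complex with actions. -/
def TwoChainComp.precategory (P : TwoChainComp C) : PC C :=
  { C₂ := P.actF.semi
    C₁ := P.actX.semi
    C₀ := P.B
    π₁ := IntAction.map P.proj_isEquivariant
    π₂ := P.actF.proj
    m := P.actF.desc _ _ P.condF
    e₁ := IntAction.map P.inr_isEquivariant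
    e₂ := P.actF.inr
    d := P.actX.proj
    c := P.actX.desc P.h (𝟙 _) P.condX
    e := P.actX.inr
    e_d := P.actX.inr_proj
    e_c := P.actX.inr_desc _ _ _
    e₂_π₂ := P.actF.inr_proj
    e₁_π₁ := by
      apply hom_ext
      · rw [reassoc_of% inl_map, inl_map, reassoc_of% inr_proj, Category.comp_id]
      · rw [reassoc_of% inr_map, inr_map, reassoc_of% P.actX.inr_desc, Category.comp_id,
          Category.id_comp]
    π₁_d := map_proj P.proj_isEquivariant
    e₂_π₁ := inr_map P.proj_isEquivariant
    e₁_π₂ := map_proj P.inr_isEquivariant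
    e_e₁ := inr_map P.inr_isEquivariant
    m_d := by
      apply hom_ext
      · rw [reassoc_of% P.actF.inl_desc, Category.assoc, inl_proj, comp_zero,
          reassoc_of% P.actF.inl_proj, zero_comp]
      · rw [reassoc_of% P.actF.inr_desc, reassoc_of% P.actF.inr_proj, Category.id_comp]
    m_c := by
      apply hom_ext
      · rw [reassoc_of% P.actF.inl_desc, Category.assoc, inl_desc, reassoc_of% inl_map, inl_desc]
        apply hom_ext
        -- On F(Z,X) the claim is h[t 1] = h[0 1], whose restriction to Z is exactly ht = 0.
        · rw [reassoc_of% P.actZ.inl_desc, P.zero, reassoc_of% inl_proj, zero_comp]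
        · rw [reassoc_of% P.actZ.inr_desc, reassoc_of% inr_proj, Category.id_comp]
      · rw [reassoc_of% P.actF.inr_desc, reassoc_of% inr_map, inr_desc, Category.comp_id,
          Category.id_comp]
    e₁_m := by
      apply hom_ext
      · rw [reassoc_of% inl_map, inl_desc, reassoc_of% P.actZ.inr_desc, Category.comp_id,
          Category.id_comp]
      · rw [reassoc_of% inr_map, inr_desc]
    e₂_m := P.actF.inr_desc _ _ _ }

/-- The morphism of precategories induced by a morphism of 2-chain complexes. -/
def TwoChainComp.Hom.precategory {P Q : TwoChainComp C} (f : TwoChainComp.Hom P Q) :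
    PC.Hom P.precategory Q.precategory where
  f₂ := IntAction.map f.equivF
  f₁ := IntAction.map f.equivX
  f₀ := f.b
  comm_π₁ := by
    -- Both sides of the square are F of one and the same morphism of actions, factored in two ways.
    have w := f.equivF.comp Q.proj_isEquivariant
    exact (map_eq_comp f.equivF Q.proj_isEquivariant w rfl rfl).symm.trans
      (map_eq_comp P.proj_isEquivariant f.equivX w
      (map_desc_comm P.condX Q.condX f.equivX f.comm_h) (map_proj _))
  comm_π₂ := map_proj _
  comm_m := map_desc_comm P.condF Q.condF f.equivF (by
    rw [Category.assoc, inl_map, reassoc_of% map_desc_comm P.condZ Q.condZ f.equivZ f.comm_t])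
  comm_e₁ := by
    have w := f.equivX.comp Q.inr_isEquivariant
    exact (map_eq_comp f.equivX Q.inr_isEquivariant w rfl rfl).symm.trans
      (map_eq_comp P.inr_isEquivariant f.equivF w
      (inr_map f.equivX).symm (inr_map f.equivZ).symm)
  comm_e₂ := (inr_map _).symm
  comm_d := map_proj _
  comm_c := map_desc_comm P.condX Q.condX f.equivX f.comm_h
  comm_e := (inr_map _).symm

variable (C) in
/-- The functor from 2-chain complexes P.inr_isEquivariantth actions to precategories. -/
def TwoChainComp.toPC : TwoChainComp C ⥤ PC C where
  obj P := P.precategory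
  map f := f.precategory
  map_id P := PC.Hom.ext' (map_eq_id (𝟙 P : P ⟶ P).equivF map_id map_id) map_id rfl
  map_comp f g := PC.Hom.ext' (map_eq_comp f.equivF g.equivF (f ≫ g).equivF
    (map_comp f.equivX g.equivX) (map_comp f.equivZ g.equivZ)) (map_comp f.equivX g.equivX) rfl

end

/-! ### The equivalence between 2-chain complexes and precategories -/

section

open IntAction

variable {C : Type u} [Category.{v} C] [HasZeroMorphisms C] [HasBinaryCoproducts C]
  [HasKernelsOfSplitEpis C] [HasReflexiveCoequalizers C]

/-- Precomposing F(x,b) with σι₁ gives σι₁x whatever b is, and σι₁ is monic; hence the base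
components may differ. -/
theorem eq_of_map_eq [(canonicalFunctor C).Faithful] {B X B' X' : C} {s : IntAction B X}
    {s' : IntAction B' X'} {b b' : B ⟶ B'} {x x' : X ⟶ X'} (w : IsEquivariant s s' b x)
    (w' : IsEquivariant s s' b' x') (h : IntAction.map w = IntAction.map w') : x = x' := by
  rw [← cancel_mono s'.inl, ← inl_map w, h, inl_map]

theorem comm_of_map_comm [(canonicalFunctor C).Faithful] {B X B₁ X₁ B₂ X₂ B' X' : C}
    {s : IntAction B X} {s₁ : IntAction B₁ X₁} {s₂ : IntAction B₂ X₂} {s' : IntAction B' X'}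
    {b₁ : B ⟶ B₁} {x₁ : X ⟶ X₁} {b₁' : B₁ ⟶ B'} {x₁' : X₁ ⟶ X'}
    {b₂ : B ⟶ B₂} {x₂ : X ⟶ X₂} {b₂' : B₂ ⟶ B'} {x₂' : X₂ ⟶ X'}
    (w₁ : IsEquivariant s s₁ b₁ x₁) (w₁' : IsEquivariant s₁ s' b₁' x₁')
    (w₂ : IsEquivariant s s₂ b₂ x₂) (w₂' : IsEquivariant s₂ s' b₂' x₂')
    (h : IntAction.map w₁ ≫ IntAction.map w₁' = IntAction.map w₂ ≫ IntAction.map w₂') :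
    x₁ ≫ x₁' = x₂ ≫ x₂' := by
  rw [← map_comp, ← map_comp] at h
  exact eq_of_map_eq _ _ h

instance [(canonicalFunctor C).Faithful] : (TwoChainComp.toPC C).Faithful where
  map_injective {P Q f g} h := by
    have hb : f.b = g.b := congrArg PC.Hom.f₀ h
    have h₁ : IntAction.map f.equivX = IntAction.map g.equivX := congrArg PC.Hom.f₁ h
    have h₂ : IntAction.map f.equivF = IntAction.map g.equivF := congrArg PC.Hom.f₂ h
    -- Cancelling twice: f₂ determines F(z,x), which determines z.
    exact TwoChainComp.Hom.ext' (eq_of_map_eq _ _ (eq_of_map_eq _ _ h₂)) (eq_of_map_eq _ _ h₁) hb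

instance [(canonicalFunctor C).Faithful] [(canonicalFunctor C).Full] :
    (TwoChainComp.toPC C).Full where
  map_surjective {P Q} f := by
    obtain ⟨f₂, f₁, b, hπ₁, hπ₂, hm, he₁, he₂, hd, hc, he⟩ := f
    change P.B ⟶ Q.B at b
    obtain ⟨x, w, rfl⟩ := exists_map_eq (s := P.actX) (s' := Q.actX) f₁ b hd he
    obtain ⟨y, v, rfl⟩ := exists_map_eq (s := P.actF) (s' := Q.actF) f₂ (IntAction.map w) hπ₂ he₂
    have hy : y ≫ Q.actZ.proj = P.actZ.proj ≫ x :=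
      comm_of_map_comm v Q.proj_isEquivariant P.proj_isEquivariant w hπ₁
    have hy' : x ≫ Q.actZ.inr = P.actZ.inr ≫ y :=
      comm_of_map_comm w Q.inr_isEquivariant P.inr_isEquivariant v he₁
    -- Compatibility with π₁ and e₁ makes (y, x) a morphism of split epimorphisms from F(Z,X) → X to
    -- F(Z',X') → X'.
    obtain ⟨z, u, rfl⟩ := exists_map_eq y x hy hy'
    have hh : x ≫ Q.h = P.h ≫ b := comm_of_map_desc_comm P.condX Q.condX w hc
    have ht := comm_of_map_desc_comm P.condF Q.condF v hm
    -- Compatibility with m is an equation after composition with the monomorphism σι₁ : X' →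
    -- F(X',B'); cancelling it leaves the square for [t 1].
    rw [Category.assoc, inl_map, ← Category.assoc, ← Category.assoc, cancel_mono] at ht
    exact ⟨TwoChainComp.Hom.mk z x b (comm_of_map_desc_comm P.condZ Q.condZ u ht) hh w u v, rfl⟩

theorem PreXMod.toRG_isEquivalence (hT : (canonicalFunctor C).IsEquivalence) :
    (PreXMod.toRG C).IsEquivalence where

theorem TwoChainComp.exists_precategory_iso [(canonicalFunctor C).IsEquivalence] (R : PC C) :
    ∃ P : TwoChainComp C, Nonempty (P.precategory ≅ R) := by
  obtain ⟨X, s, φ, hα, hβ⟩ := exists_semi_iso R.d R.e R.e_d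
  obtain ⟨Y, r, χ, hα', hβ'⟩ := exists_semi_iso R.π₂ R.e₂ R.e₂_π₂
  have hs : φ.inv ≫ s.proj = R.d := by rw [← hα, φ.inv_hom_id_assoc]
  have hs' : R.e ≫ φ.inv = s.inr := by rw [← hβ, Category.assoc, φ.hom_inv_id, Category.comp_id]
  have hr : χ.inv ≫ r.proj = R.π₂ := by rw [← hα', χ.inv_hom_id_assoc]
  have hr' : R.e₂ ≫ χ.inv = r.inr := by
    rw [← hβ', Category.assoc, χ.hom_inv_id, Category.comp_id]
  -- The pairs (π₁, c) and (e₁, e), read through φ and χ, restrict to the kernels as p and q.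
  obtain ⟨p, wp, hp⟩ := exists_map_eq (s := r) (s' := s) (χ.hom ≫ R.π₁ ≫ φ.inv) R.c
    (by rw [Category.assoc, Category.assoc, hs, R.π₁_d, reassoc_of% hα'])
    (by rw [reassoc_of% hβ', reassoc_of% R.e₂_π₁, hs'])
  obtain ⟨q, wq, hq⟩ := exists_map_eq (s := s) (s' := r) (φ.hom ≫ R.e₁ ≫ χ.inv) R.e
    (by rw [Category.assoc, Category.assoc, hr, R.e₁_π₂, reassoc_of% hα])
    (by rw [reassoc_of% hβ, reassoc_of% R.e_e₁, hr'])
  have hqp : q ≫ p = 𝟙 X := by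
    rw [← cancel_mono s.inl, Category.assoc, ← inl_map wp, ← reassoc_of% inl_map wq, hq, hp]
    simp [reassoc_of% R.e₁_π₁]
  obtain ⟨Z, a, ψ, hα'', hβ''⟩ := exists_semi_iso p q hqp
  -- The restriction of m to Y is killed by d, as dm = dπ₂, so it factors through X.
  obtain ⟨v, hv⟩ := exists_lift_inl (s := s) (r.inl ≫ χ.hom ≫ R.m ≫ φ.inv) (by
    rw [Category.assoc, Category.assoc, Category.assoc, hs, R.m_d, reassoc_of% hα',
      reassoc_of% inl_proj, zero_comp])
  have hqv : q ≫ v = 𝟙 X := by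
    rw [← cancel_mono s.inl, Category.assoc, hv, ← reassoc_of% inl_map wq, hq]
    simp [reassoc_of% R.e₁_m]
  -- The action of C₁ on Y becomes an action of F(X,B) on F(Z,X), with B = C₀.
  let F := r.transport φ.symm ψ.symm
  have wF : IsEquivariant r F φ.symm.hom ψ.symm.hom := r.transport_isEquivariant _ _
  have wF' : IsEquivariant F r φ.hom ψ.hom := wF.inv
  let κ : F.semi ≅ R.C₂ := mapIso wF' ≪≫ χ
  have hκ : κ.hom = IntAction.map wF' ≫ χ.hom := rfl
  have hX : s.inr ≫ φ.hom ≫ R.c = 𝟙 _ := by rw [reassoc_of% hβ, R.e_c]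
  have hZ : a.inr ≫ ψ.hom ≫ v = 𝟙 _ := by rw [reassoc_of% hβ'', hqv]
  have condX := s.flatι_desc_of_eq _ rfl hX
  have condZ := a.flatι_desc_of_eq _ rfl hZ
  have dX : s.desc _ _ condX = φ.hom ≫ R.c := s.eq_desc _ rfl hX condX
  have dZ : a.desc _ _ condZ = ψ.hom ≫ v := a.eq_desc _ rfl hZ condZ
  have hF : F.inl ≫ κ.hom ≫ R.m ≫ φ.inv = a.desc _ _ condZ ≫ s.inl := by
    rw [hκ, dZ, Category.assoc, Category.assoc, hv, reassoc_of% inl_map wF']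
  have hF' : F.inr ≫ κ.hom ≫ R.m ≫ φ.inv = 𝟙 _ := by
    rw [hκ, Category.assoc, reassoc_of% inr_map wF', reassoc_of% hβ', reassoc_of% R.e₂_m,
      φ.hom_inv_id]
  have condF := F.flatι_desc_of_eq _ hF hF'
  have wp' : IsEquivariant F s (s.desc _ _ condX) a.proj := by
    rw [dX, ← hα'']
    exact wF'.comp wp
  have wq' : IsEquivariant s F s.inr a.inr := by
    have e : a.inr = q ≫ ψ.inv := by rw [← hβ'', Category.assoc, ψ.hom_inv_id, Category.comp_id]
    rw [← hs', e]
    exact wq.comp wF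
  let P : TwoChainComp C :=
    { Z := Z
      X := X
      B := R.C₀
      t := a.inl ≫ ψ.hom ≫ v
      h := s.inl ≫ φ.hom ≫ R.c
      zero := by
        -- By cm = cπ₁, hv = hp; and p vanishes on Z, since through ψ it is the projection F(Z,X) →
        -- X.
        rw [Category.assoc, Category.assoc, reassoc_of% hv, φ.inv_hom_id_assoc, R.m_c]
        have e : χ.hom ≫ R.π₁ = IntAction.map wp ≫ φ.hom := by simp [hp]
        rw [reassoc_of% e, reassoc_of% inl_map wp, reassoc_of% hα'', reassoc_of% inl_proj,
          zero_comp]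
      actX := s
      actZ := a
      actF := F
      condX := condX
      condZ := condZ
      condF := condF
      proj_comm := wp'.symm
      inr_comm := wq'.symm }
  let f : PC.Hom P.precategory R :=
    { f₂ := κ.hom
      f₁ := φ.hom
      f₀ := 𝟙 R.C₀
      comm_π₁ := by
        change κ.hom ≫ R.π₁ = IntAction.map wp' ≫ φ.hom
        rw [map_eq_comp wF' wp wp' dX hα''.symm, hp, hκ]
        simp
      comm_π₂ := by
        change κ.hom ≫ R.π₂ = F.proj ≫ φ.hom
        rw [hκ, Category.assoc, hα', map_proj]
      comm_m := by
        change κ.hom ≫ R.m = F.desc _ _ condF ≫ φ.hom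
        rw [F.eq_desc _ hF hF' condF]
        simp
      comm_e₁ := by
        change φ.hom ≫ R.e₁ = IntAction.map wq' ≫ IntAction.map wF' ≫ χ.hom
        -- Factoring through an identity exchanges the composite for `wq`, whose components equal
        -- its own only propositionally.
        rw [← reassoc_of% map_comp wq' wF', map_eq_comp wq (IsEquivariant.id r) (wq'.comp wF')
          (by rw [hβ, Category.comp_id]) (by rw [hβ'', Category.comp_id]), map_id, hq]
        simp
      comm_e₂ := by
        change φ.hom ≫ R.e₂ = F.inr ≫ IntAction.map wF' ≫ χ.hom
        rw [reassoc_of% inr_map wF', hβ']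
      comm_d := hα.trans (Category.comp_id _).symm
      comm_c := dX.symm.trans (Category.comp_id _).symm
      comm_e := (Category.id_comp _).trans hβ.symm }
  exact ⟨P, ⟨PC.isoMk f κ φ (Iso.refl _) rfl rfl rfl⟩⟩

theorem TwoChainComp.toPC_isEquivalence (hT : (canonicalFunctor C).IsEquivalence) :
    (TwoChainComp.toPC C).IsEquivalence where
  essSurj := ⟨fun R => TwoChainComp.exists_precategory_iso R⟩

end

end IntPrecat

end

theorem mainTheorem3 (C : Type u) [Category.{v} C] [HasZeroMorphisms C] [HasBinaryProducts C]
    [HasBinaryCoproducts C] [IntPrecat.HasKernelsOfSplitEpis C] [HasReflexiveCoequalizers C]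
    (hT : (IntPrecat.canonicalFunctor C).IsEquivalence) :
    Nonempty (IntPrecat.RG C ≌ IntPrecat.PreXMod C) ∧
      Nonempty (IntPrecat.PC C ≌ IntPrecat.TwoChainComp C) := by
  have := IntPrecat.PreXMod.toRG_isEquivalence hT
  have := IntPrecat.TwoChainComp.toPC_isEquivalence hT
  exact ⟨⟨(IntPrecat.PreXMod.toRG C).asEquivalence.symm⟩,
    ⟨(IntPrecat.TwoChainComp.toPC C).asEquivalence.symm⟩⟩
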